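/- Let $S$ be a cancellative monoid (that is, $S$ is both left and right cancellative) satisfying the common right multiple condition (CRM): for all $s,c\in S$ with $c$ cancellative there exist $t,d\in S$ with $d$ cancellative such that $sd=ct$. Call a right $S$-act $X$ weakly torsion free if for all $x,y\in X$ and every cancellative element $c\in S$, $xc=yc$ implies $x=y$. Then every right $S$-act $A$ has a weakly torsion free cover, i.e. there are a weakly torsion free right $S$-act $P$ and an $S$-map $g:P\to A$ such that (1) for every weakly torsion free right $S$-act $P'$ and every $S$-map $g':P'\to A$ there is an $S$-map $f:P'\to P$ with $g'=gf$; and (2) every $S$-map $f:P\to P$ with $gf=g$ is an isomorphism of $S$-acts. -/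

import Mathlib

universe u v w

/-! A right `S`-act is a type `X` with `[MulAction Sᵐᵒᵖ X]`; the element `x s` of `X` is
`MulOpposite.op s • x`, and an `S`-map is an element of `X →[Sᵐᵒᵖ] Y`. -/

/-- The common right multiple condition: for all `s, c` with `c` cancellative there are `t, d` with
`d` cancellative and `s d = c t`. A cancellative element is one that is both left and right
cancellable. -/
def IsCRM (S : Type u) [Monoid S] : Prop :=
  ∀ s c : S, IsRegular c → ∃ t d : S, IsRegular d ∧ s * d = c * t

/-- A right `S`-act is weakly torsion free if `x c = y c` with `c` cancellative implies `x = y`. -/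
def IsWeaklyTorsionFree (S : Type u) [Monoid S] (X : Type w) [MulAction Sᵐᵒᵖ X] : Prop :=
  ∀ (x y : X) (c : S), IsRegular c → MulOpposite.op c • x = MulOpposite.op c • y → x = y

/-- `g : P → A` is an `𝒳`-precover of `A`, for a class `𝒳` of right `S`-acts. -/
def IsActPrecover {S : Type u} [Monoid S] (𝒳 : ∀ (X : Type w) [MulAction Sᵐᵒᵖ X], Prop)
    {P A : Type w} [MulAction Sᵐᵒᵖ P] [MulAction Sᵐᵒᵖ A] (g : P →[Sᵐᵒᵖ] A) : Prop :=
  𝒳 P ∧ ∀ (P' : Type w) [MulAction Sᵐᵒᵖ P'], 𝒳 P' →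
    ∀ g' : P' →[Sᵐᵒᵖ] A, ∃ f : P' →[Sᵐᵒᵖ] P, g.comp f = g'

/-- An `S`-map is an isomorphism if it has a two-sided inverse `S`-map. -/
def IsActIso {S : Type u} [Monoid S] {X Y : Type w} [MulAction Sᵐᵒᵖ X] [MulAction Sᵐᵒᵖ Y]
    (f : X →[Sᵐᵒᵖ] Y) : Prop :=
  ∃ h : Y →[Sᵐᵒᵖ] X, h.comp f = MulActionHom.id Sᵐᵒᵖ ∧ f.comp h = MulActionHom.id Sᵐᵒᵖ

/-- `g : P → A` is an `𝒳`-cover of `A`: an `𝒳`-precover such that every `S`-map `f : P → P` with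
`g f = g` is an isomorphism. -/
def IsActCover {S : Type u} [Monoid S] (𝒳 : ∀ (X : Type w) [MulAction Sᵐᵒᵖ X], Prop)
    {P A : Type w} [MulAction Sᵐᵒᵖ P] [MulAction Sᵐᵒᵖ A] (g : P →[Sᵐᵒᵖ] A) : Prop :=
  IsActPrecover 𝒳 g ∧ ∀ f : P →[Sᵐᵒᵖ] P, g.comp f = g → IsActIso f

/-! In a weakly torsion free act, CRM makes "x t = y s for some s, t" an equivalence relation whose
classes are subacts. Once a base point is fixed in such a class, every element is a fraction of it,
so a morphism is determined by the image of the base point. Hence a pointed connected act over `A`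
is encoded by a subset of a fixed set, with pointed morphisms over `A` corresponding to inclusion
(`le_of_code_subset`). Directed colimits bound chains, so Zorn gives maximal acts; moving the base
point of the target shows that every morphism over `A` out of one is invertible. The cover is the
coproduct of one maximal act from each class under existence of a morphism over `A`. Endomorphisms
over `A` cannot permute the summands, and they are invertible on each. -/

section

open MulOpposite

/-- A pointed connected weakly torsion free act over `A`: every element `x` satisfies `x t = x₀ s`
for some `s, t`, where `x₀` is the base point. -/
structure PointedActOver (S : Type u) [Monoid S] (A : Type w) [MulAction Sᵐᵒᵖ A] where
  carrier : Type w
  [act : MulAction Sᵐᵒᵖ carrier]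
  torsionFree : IsWeaklyTorsionFree S carrier
  pt : carrier
  connected : ∀ x : carrier, ∃ s t : S, op t • x = op s • pt
  toBase : carrier →[Sᵐᵒᵖ] A

namespace PointedActOver

attribute [instance] PointedActOver.act

theorem eq_of_op_smul_eq {S : Type u} [Monoid S] [IsCancelMul S] {X : Type w}
    [MulAction Sᵐᵒᵖ X] (hX : IsWeaklyTorsionFree S X) {x y : X} (c : S)
    (h : op c • x = op c • y) : x = y :=
  hX x y c (IsRegular.all c) h

theorem op_mul_smul {S : Type u} [Monoid S] {X : Type w} [MulAction Sᵐᵒᵖ X] (s t : S) (x : X) :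
    op (s * t) • x = op t • op s • x := by
  rw [op_mul, mul_smul]

variable {S : Type u} [Monoid S] {A : Type w} [MulAction Sᵐᵒᵖ A]

/-- The morphisms of acts over `A`, not required to preserve base points. -/
def IsOver {X Y : PointedActOver S A} (f : X.carrier →[Sᵐᵒᵖ] Y.carrier) : Prop :=
  ∀ x, Y.toBase (f x) = X.toBase x

/-- There is a base point preserving morphism over `A`. -/
def Le (X Y : PointedActOver S A) : Prop :=
  ∃ f : X.carrier →[Sᵐᵒᵖ] Y.carrier, f X.pt = Y.pt ∧ IsOver f

theorem Le.refl (X : PointedActOver S A) : Le X X :=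
  ⟨MulActionHom.id _, rfl, fun _ => rfl⟩

theorem Le.trans {X Y Z : PointedActOver S A} : Le X Y → Le Y Z → Le X Z := by
  rintro ⟨f, hf, hf'⟩ ⟨g, hg, hg'⟩
  exact ⟨g.comp f, by simp [hf, hg], fun x => by simp [hf' x, hg' (f x)]⟩

/-- The pairs of fractions `s / t`, `s' / t'` that name the same element `y` of `X` relative to the
base point, together with the image of `y` in `A`. It determines `X` up to isomorphism. -/
def code (X : PointedActOver S A) : Set ((S × S) × (S × S) × A) :=
  {p | ∃ y : X.carrier, op p.1.2 • y = op p.1.1 • X.pt ∧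
    op p.2.1.2 • y = op p.2.1.1 • X.pt ∧ X.toBase y = p.2.2}

theorem Le.code_subset {X Y : PointedActOver S A} (h : Le X Y) : X.code ⊆ Y.code := by
  obtain ⟨f, hf, hf'⟩ := h
  rintro ⟨⟨s, t⟩, ⟨s', t'⟩, a⟩ ⟨y, h1, h2, h3⟩
  refine ⟨f y, ?_, ?_, (hf' y).trans h3⟩
  · simpa [hf] using congrArg f h1
  · simpa [hf] using congrArg f h2

/-! ### Rigidity of pointed morphisms, and recovery of an act from its code -/

variable [IsCancelMul S]

theorem pointed_hom_unique {X Y : PointedActOver S A} {f g : X.carrier →[Sᵐᵒᵖ] Y.carrier}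
    (h : f X.pt = g X.pt) (x : X.carrier) : f x = g x := by
  obtain ⟨s, t, hx⟩ := X.connected x
  apply eq_of_op_smul_eq Y.torsionFree t
  rw [← map_smul, ← map_smul, hx, map_smul, map_smul, h]

theorem exists_common_right_multiple (hS : IsCRM S) (s c : S) : ∃ t d : S, s * d = c * t := by
  obtain ⟨t, d, -, h⟩ := hS s c (IsRegular.all c)
  exact ⟨t, d, h⟩

theorem exists_smul_fraction (hS : IsCRM S) {X : Type w} [MulAction Sᵐᵒᵖ X] {x x₀ : X} {s t : S}
    (h : op t • x = op s • x₀) (r : S) :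
    ∃ q d : S, op d • op r • x = op (s * q) • x₀ ∧ r * d = t * q := by
  obtain ⟨q, d, hqd⟩ := exists_common_right_multiple hS r t
  refine ⟨q, d, ?_, hqd⟩
  rw [← op_mul_smul, hqd, op_mul_smul, op_mul_smul, h]

/-- Send x to the element of `Y` named by any of its fractions. Recording pairs of fractions in the
code makes this independent of the choice. -/
theorem le_of_code_subset (hS : IsCRM S) {X Y : PointedActOver S A} (h : X.code ⊆ Y.code) :
    Le X Y := by
  have total : ∀ x : X.carrier, ∃ y : Y.carrier, ∀ s t : S, op t • x = op s • X.pt →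
      op t • y = op s • Y.pt ∧ Y.toBase y = X.toBase x := by
    intro x
    obtain ⟨s, t, hx⟩ := X.connected x
    obtain ⟨y, hy, -, -⟩ := h (show ((s, t), (s, t), X.toBase x) ∈ X.code from ⟨x, hx, hx, rfl⟩)
    refine ⟨y, fun s' t' hx' => ?_⟩
    obtain ⟨z, hz, hz', hza⟩ :=
      h (show ((s, t), (s', t'), X.toBase x) ∈ X.code from ⟨x, hx, hx', rfl⟩)
    obtain rfl : z = y := eq_of_op_smul_eq Y.torsionFree t (hz.trans hy.symm)
    exact ⟨hz', hza⟩
  choose f hf using total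
  refine ⟨⟨f, fun r x => ?_⟩, ?_, fun x => ?_⟩
  · induction r with | _ r
    obtain ⟨s, t, hx⟩ := X.connected x
    -- With r d = t q, the fraction (s q) / d names x r in `X`, and also (f x) r in `Y`.
    obtain ⟨q, d, hd, hqd⟩ := exists_smul_fraction hS hx r
    apply eq_of_op_smul_eq Y.torsionFree d
    rw [(hf _ _ _ hd).1]
    change _ = op d • op r • f x
    rw [← op_mul_smul, hqd, op_mul_smul, op_mul_smul, (hf x s t hx).1]
  · have := (hf X.pt 1 1 rfl).1
    rwa [op_one, one_smul, one_smul] at this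
  · obtain ⟨s, t, hx⟩ := X.connected x
    exact (hf x s t hx).2

/-- Change of base point. -/
def repoint (hS : IsCRM S) (X : PointedActOver S A) (x₁ : X.carrier) : PointedActOver S A where
  carrier := X.carrier
  torsionFree := X.torsionFree
  pt := x₁
  connected := fun x => by
    obtain ⟨s, t, hx⟩ := X.connected x
    obtain ⟨s₁, t₁, hx₁⟩ := X.connected x₁
    obtain ⟨q, d, hqd⟩ := exists_common_right_multiple hS s₁ s
    refine ⟨t₁ * d, t * q, ?_⟩
    rw [op_mul_smul, op_mul_smul, hx, hx₁, ← op_mul_smul, ← op_mul_smul, hqd]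
  toBase := X.toBase

/-! ### Directed colimits -/

section DirectedColimit

variable {ι : Type w} (F : ι → PointedActOver S A)

/-- Two elements of members of a family are identified when some member receives pointed morphisms
making their images equal. -/
def colimitRel (p q : Σ i, (F i).carrier) : Prop :=
  ∃ (k : ι) (f : (F p.1).carrier →[Sᵐᵒᵖ] (F k).carrier)
    (g : (F q.1).carrier →[Sᵐᵒᵖ] (F k).carrier),
    (f (F p.1).pt = (F k).pt ∧ IsOver f) ∧ (g (F q.1).pt = (F k).pt ∧ IsOver g) ∧ f p.2 = g q.2

variable {F}

theorem colimitRel_equivalence (hF : ∀ i j, ∃ k, Le (F i) (F k) ∧ Le (F j) (F k)) :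
    Equivalence (colimitRel F) where
  refl p := ⟨p.1, MulActionHom.id _, MulActionHom.id _, ⟨rfl, fun _ => rfl⟩,
    ⟨rfl, fun _ => rfl⟩, rfl⟩
  symm := fun ⟨k, f, g, hf, hg, h⟩ => ⟨k, g, f, hg, hf, h.symm⟩
  trans := by
    rintro p q r ⟨k, f, g, hf, hg, h⟩ ⟨l, f', g', hf', hg', h'⟩
    obtain ⟨m, ⟨a, ha, ha'⟩, ⟨b, hb, hb'⟩⟩ := hF k l
    refine ⟨m, a.comp f, b.comp g', ⟨by simp [hf.1, ha], fun x => ?_⟩,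
      ⟨by simp [hg'.1, hb], fun x => ?_⟩, ?_⟩
    · simp [ha' (f x), hf.2 x]
    · simp [hb' (g' x), hg'.2 x]
    -- Both routes from the middle member to the common bound agree by rigidity, so no compatible
    -- system of transition maps is needed.
    · have := pointed_hom_unique (f := a.comp g) (g := b.comp f')
        (by simp [hg.1, hf'.1, ha, hb]) q.2
      simp only [MulActionHom.comp_apply] at this ⊢
      rw [h, this, h']

theorem exists_upper_bound [Nonempty ι] (hF : ∀ i j, ∃ k, Le (F i) (F k) ∧ Le (F j) (F k)) :
    ∃ Y : PointedActOver S A, ∀ i, Le (F i) Y := by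
  let st : Setoid (Σ i, (F i).carrier) := ⟨colimitRel F, colimitRel_equivalence hF⟩
  have smul_rel : ∀ (r : Sᵐᵒᵖ) (p q : Σ i, (F i).carrier), st p q → st (r • p) (r • q) := by
    rintro r ⟨i, x⟩ ⟨j, y⟩ ⟨k, f, g, hf, hg, h⟩
    refine ⟨k, f, g, hf, hg, ?_⟩
    change f (r • x) = g (r • y)
    rw [map_smul, map_smul]
    exact congrArg (r • ·) h
  let act : MulAction Sᵐᵒᵖ (Quotient st) :=
    { smul := fun r => Quotient.map (r • ·) (smul_rel r)
      one_smul := by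
        rintro ⟨p⟩
        exact congrArg (Quotient.mk st) (one_smul _ p)
      mul_smul := by
        rintro r r' ⟨p⟩
        exact congrArg (Quotient.mk st) (mul_smul r r' p) }
  have pt_eq : ∀ i j, Quotient.mk st ⟨i, (F i).pt⟩ = Quotient.mk st ⟨j, (F j).pt⟩ := by
    intro i j
    obtain ⟨k, ⟨f, hf⟩, ⟨g, hg⟩⟩ := hF i j
    exact Quotient.sound ⟨k, f, g, hf, hg, hf.1.trans hg.1.symm⟩
  let i₀ : ι := Classical.arbitrary ι
  let Y : PointedActOver S A :=
    { carrier := Quotient st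
      torsionFree := by
        rintro ⟨i, x⟩ ⟨j, y⟩ c - h
        obtain ⟨k, f, g, hf, hg, h⟩ := Quotient.exact h
        change (F i).carrier →[Sᵐᵒᵖ] (F k).carrier at f
        change (F j).carrier →[Sᵐᵒᵖ] (F k).carrier at g
        change f (op c • x) = g (op c • y) at h
        refine Quotient.sound ⟨k, f, g, hf, hg, ?_⟩
        apply eq_of_op_smul_eq (F k).torsionFree c
        rw [map_smul, map_smul] at h
        exact h
      pt := Quotient.mk st ⟨i₀, (F i₀).pt⟩
      connected := by
        rintro ⟨i, x⟩
        obtain ⟨s, t, h⟩ := (F i).connected x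
        refine ⟨s, t, ?_⟩
        rw [pt_eq i₀ i]
        exact congrArg (fun z => Quotient.mk st ⟨i, z⟩) h
      toBase :=
        { toFun := Quotient.lift (fun p : Σ i, (F i).carrier => (F p.1).toBase p.2) (by
            rintro ⟨i, x⟩ ⟨j, y⟩ ⟨k, f, g, hf, hg, h⟩
            change (F i).toBase x = (F j).toBase y
            rw [← hf.2 x, ← hg.2 y]
            exact congrArg _ h)
          map_smul' := by
            rintro r ⟨i, x⟩
            exact map_smul (F i).toBase r x } }
  exact ⟨Y, fun i => ⟨⟨fun x => Quotient.mk st ⟨i, x⟩, fun _ _ => rfl⟩, pt_eq i i₀, fun _ => rfl⟩⟩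

end DirectedColimit

/-! ### Maximal acts -/

/-- A maximal pointed connected act: its code is maximal among codes. -/
def IsMax (X : PointedActOver S A) : Prop :=
  ∀ Y : PointedActOver S A, Le X Y → Le Y X

/-- A morphism over `A` out of a maximal act is invertible. -/
theorem IsMax.exists_inverse (hS : IsCRM S) {X Y : PointedActOver S A} (hX : X.IsMax)
    {h : X.carrier →[Sᵐᵒᵖ] Y.carrier} (hh : IsOver h) :
    ∃ k : Y.carrier →[Sᵐᵒᵖ] X.carrier, IsOver k ∧ (∀ x, k (h x) = x) ∧ ∀ y, h (k y) = y := by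
  -- Repointing at the image of the base point makes `h` pointed, so maximality returns a pointed
  -- map `k`; rigidity makes both composites identities.
  obtain ⟨k, hk, hk'⟩ := hX (Y.repoint hS (h X.pt)) ⟨h, rfl, hh⟩
  change Y.carrier →[Sᵐᵒᵖ] X.carrier at k
  change k (h X.pt) = X.pt at hk
  refine ⟨k, hk', fun x => ?_, fun y => ?_⟩
  · exact pointed_hom_unique (f := k.comp h) (g := MulActionHom.id _) hk x
  · exact pointed_hom_unique (X := Y.repoint hS (h X.pt)) (Y := Y.repoint hS (h X.pt))
      (f := h.comp k) (g := MulActionHom.id _) (congrArg h hk) y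

end PointedActOver

end

section

open MulOpposite PointedActOver

/-- Zorn is applied to codes rather than acts: a chain of codes is a small index type, so its
colimit stays in the universe of `A`. -/
theorem PointedActOver.exists_isMax {S : Type u} [Monoid S] [IsCancelMul S] (hS : IsCRM S)
    {A : Type (max u v)} [MulAction Sᵐᵒᵖ A] (X : PointedActOver S A) :
    ∃ Y : PointedActOver S A, Le X Y ∧ Y.IsMax := by
  obtain ⟨m, hXm, ⟨Y, rfl⟩, hY⟩ := zorn_le_nonempty₀
    (Set.range (code : PointedActOver S A → _)) (fun c hc hchain y hy => by
      choose F hF using fun z : c => hc z.2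
      have : Nonempty c := ⟨⟨y, hy⟩⟩
      obtain ⟨Y, hY⟩ := exists_upper_bound (F := F) (fun i j => by
        rcases hchain.total i.2 j.2 with h | h
        · exact ⟨j, le_of_code_subset hS (by rw [hF, hF]; exact h), Le.refl _⟩
        · exact ⟨i, Le.refl _, le_of_code_subset hS (by rw [hF, hF]; exact h)⟩)
      exact ⟨Y.code, ⟨Y, rfl⟩, fun z hz => (hF ⟨z, hz⟩).symm.subset.trans (hY ⟨z, hz⟩).code_subset⟩)
    X.code ⟨X, rfl⟩
  exact ⟨Y, le_of_code_subset hS hXm, fun Z hZ =>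
    le_of_code_subset hS (hY ⟨Z, rfl⟩ hZ.code_subset)⟩

/-- A small family of pairwise incomparable maximal acts receiving a morphism over `A` from every
pointed connected weakly torsion free act. -/
theorem PointedActOver.exists_maximal_family {S : Type u} [Monoid S] [IsCancelMul S] (hS : IsCRM S)
    (A : Type (max u v)) [MulAction Sᵐᵒᵖ A] :
    ∃ (I : Type (max u v)) (M : I → PointedActOver S A), (∀ i, (M i).IsMax) ∧
      (∀ i j, ∀ h : (M i).carrier →[Sᵐᵒᵖ] (M j).carrier, IsOver h → i = j) ∧
      ∀ X : PointedActOver S A, ∃ (i : I) (h : X.carrier →[Sᵐᵒᵖ] (M i).carrier), IsOver h := by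
  let C := {c : Set ((S × S) × (S × S) × A) // ∃ X : PointedActOver S A, X.IsMax ∧ X.code = c}
  choose N hN hNc using fun c : C => c.2
  let st : Setoid C :=
    { r := fun c d => ∃ h : (N c).carrier →[Sᵐᵒᵖ] (N d).carrier, IsOver h
      iseqv :=
        { refl := fun c => ⟨MulActionHom.id _, fun _ => rfl⟩
          -- Symmetry is where maximality enters.
          symm := fun {c d} ⟨h, hh⟩ => by
            obtain ⟨k, hk, -⟩ := (hN c).exists_inverse hS hh
            exact ⟨k, hk⟩
          trans := fun {c d e} ⟨h, hh⟩ ⟨k, hk⟩ =>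
            ⟨k.comp h, fun x => (hk (h x)).trans (hh x)⟩ } }
  refine ⟨Quotient st, fun i => N i.out, fun i => hN _, fun i j h hh => ?_, fun X => ?_⟩
  · rw [← i.out_eq, ← j.out_eq]
    exact Quotient.sound ⟨h, hh⟩
  · obtain ⟨Y, ⟨f, -, hf⟩, hY⟩ := PointedActOver.exists_isMax hS X
    let c : C := ⟨Y.code, Y, hY, rfl⟩
    obtain ⟨g, -, hg⟩ := le_of_code_subset hS (X := Y) (Y := N c) (hNc c).symm.subset
    obtain ⟨k, hk⟩ := st.symm (Quotient.mk_out (s := st) c)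
    exact ⟨Quotient.mk st c, k.comp (g.comp f),
      fun x => (hk _).trans ((hg _).trans (hf x))⟩

/-! ### Connected components and the coproduct -/

/-- Every weakly torsion free act over `A` maps to the coproduct of a family of acts over `A` that
receives a morphism from each pointed connected one. -/
theorem exists_hom_sigma {S : Type u} [Monoid S] [IsCancelMul S] (hS : IsCRM S)
    {A : Type w} [MulAction Sᵐᵒᵖ A] {I : Type w} (M : I → PointedActOver S A)
    (hM : ∀ X : PointedActOver S A, ∃ (i : I) (h : X.carrier →[Sᵐᵒᵖ] (M i).carrier), IsOver h)
    {Q : Type w} [MulAction Sᵐᵒᵖ Q] (hQ : IsWeaklyTorsionFree S Q) (g : Q →[Sᵐᵒᵖ] A) :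
    ∃ f : Q →[Sᵐᵒᵖ] (Σ i, (M i).carrier), ∀ x, (M (f x).1).toBase (f x).2 = g x := by
  let st : Setoid Q :=
    { r := fun x y => ∃ s t : S, op t • x = op s • y
      iseqv :=
        { refl := fun x => ⟨1, 1, rfl⟩
          symm := fun ⟨s, t, h⟩ => ⟨t, s, h.symm⟩
          trans := by
            rintro x y z ⟨s, t, h⟩ ⟨s', t', h'⟩
            obtain ⟨q, d, hqd⟩ := exists_common_right_multiple hS s t'
            refine ⟨s' * q, t * d, ?_⟩
            rw [op_mul_smul, h, ← op_mul_smul, hqd, op_mul_smul, h', op_mul_smul] } }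
  have mk_smul : ∀ (r : Sᵐᵒᵖ) (x : Q), Quotient.mk st (r • x) = Quotient.mk st x := by
    intro r x
    refine Quotient.sound ⟨r.unop, 1, ?_⟩
    simp
  let act (κ : Quotient st) : MulAction Sᵐᵒᵖ {x : Q // Quotient.mk st x = κ} :=
    { smul := fun r x => ⟨r • x.1, (mk_smul r x.1).trans x.2⟩
      one_smul := fun x => Subtype.ext (one_smul _ x.1)
      mul_smul := fun r r' x => Subtype.ext (mul_smul r r' x.1) }
  let X (κ : Quotient st) : PointedActOver S A :=
    { carrier := {x : Q // Quotient.mk st x = κ}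
      torsionFree := fun x y c hc h => Subtype.ext (hQ x.1 y.1 c hc (congrArg Subtype.val h))
      pt := ⟨κ.out, κ.out_eq⟩
      connected := fun x => by
        obtain ⟨s, t, h⟩ := Quotient.exact (x.2.trans κ.out_eq.symm)
        exact ⟨s, t, Subtype.ext h⟩
      toBase := ⟨fun x => g x.1, fun r x => map_smul g r x.1⟩ }
  choose i h hh using fun κ => hM (X κ)
  let f (x : Q) : Σ i, (M i).carrier := ⟨i (Quotient.mk st x), h _ ⟨x, rfl⟩⟩
  -- A free κ allows x r to be viewed in the component of x.
  have hf : ∀ (κ) (x : Q) (hx : Quotient.mk st x = κ), f x = ⟨i κ, h κ ⟨x, hx⟩⟩ := by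
    rintro κ x rfl
    rfl
  refine ⟨⟨f, fun r x => ?_⟩, fun x => hh (Quotient.mk st x) ⟨x, rfl⟩⟩
  rw [hf (Quotient.mk st x) (r • x) (mk_smul r x)]
  exact congrArg (Sigma.mk _) (map_smul (h (Quotient.mk st x)) r ⟨x, rfl⟩)

/-- An endomorphism over `A` of the coproduct of pairwise incomparable maximal acts restricts to an
endomorphism of each summand. -/
theorem exists_summand_hom {S : Type u} [Monoid S]
    {A : Type w} [MulAction Sᵐᵒᵖ A] {I : Type w} {M : I → PointedActOver S A}
    (hinc : ∀ i j, ∀ h : (M i).carrier →[Sᵐᵒᵖ] (M j).carrier, IsOver h → i = j)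
    (f : (Σ i, (M i).carrier) →[Sᵐᵒᵖ] (Σ i, (M i).carrier))
    (hf : ∀ p, (M (f p).1).toBase (f p).2 = (M p.1).toBase p.2) (i : I) :
    ∃ h : (M i).carrier →[Sᵐᵒᵖ] (M i).carrier, IsOver h ∧ ∀ x, f ⟨i, x⟩ = ⟨i, h x⟩ := by
  have fst_smul : ∀ (r : Sᵐᵒᵖ) (x : (M i).carrier), (f ⟨i, r • x⟩).1 = (f ⟨i, x⟩).1 :=
    fun r x => by
      have h : f ⟨i, r • x⟩ = r • f ⟨i, x⟩ := map_smul f r ⟨i, x⟩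
      rw [h]
      rfl
  obtain ⟨j, hj⟩ : ∃ j, ∀ x, (f ⟨i, x⟩).1 = j := by
    refine ⟨(f ⟨i, (M i).pt⟩).1, fun x => ?_⟩
    obtain ⟨s, t, h⟩ := (M i).connected x
    rw [← fst_smul (op t) x, h, fst_smul]
  have key : ∀ x, ∃ y : (M j).carrier, f ⟨i, x⟩ = ⟨j, y⟩ := by
    intro x
    obtain rfl := hj x
    exact ⟨_, rfl⟩
  choose h hh using key
  let k : (M i).carrier →[Sᵐᵒᵖ] (M j).carrier := ⟨h, fun r x => by
    have h1 : f ⟨i, r • x⟩ = r • f ⟨i, x⟩ := map_smul f r ⟨i, x⟩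
    rw [hh, hh] at h1
    exact eq_of_heq (Sigma.mk.inj h1).2⟩
  have hk : IsOver k := fun x => by
    have h1 := hf ⟨i, x⟩
    rw [hh] at h1
    exact h1
  obtain rfl := hinc i j k hk
  exact ⟨k, hk, hh⟩

end

theorem mainTheorem7 (S : Type u) [Monoid S] [IsCancelMul S] (hS : IsCRM S)
    (A : Type (max u v)) [MulAction Sᵐᵒᵖ A] :
    ∃ (P : Type (max u v)) (_ : MulAction Sᵐᵒᵖ P) (g : P →[Sᵐᵒᵖ] A),
      IsActCover (fun (X : Type (max u v)) [MulAction Sᵐᵒᵖ X] => IsWeaklyTorsionFree S X) g := by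
  obtain ⟨I, M, hmax, hinc, hM⟩ := PointedActOver.exists_maximal_family.{u, v} hS A
  refine ⟨Σ i, (M i).carrier, inferInstance,
    ⟨fun p => (M p.1).toBase p.2, fun r p => map_smul (M p.1).toBase r p.2⟩,
    ⟨?_, fun Q _ hQ g' => ?_⟩, fun f hf => ?_⟩
  · rintro ⟨i, x⟩ ⟨j, y⟩ c hc h
    obtain rfl : i = j := congrArg Sigma.fst h
    rw [(M i).torsionFree x y c hc (eq_of_heq (Sigma.mk.inj h).2)]
  · obtain ⟨f, hf⟩ := exists_hom_sigma hS M hM hQ g'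
    exact ⟨f, MulActionHom.ext hf⟩
  · choose h hh hfh using exists_summand_hom hinc f (fun p => DFunLike.congr_fun hf p)
    choose k hk hkh hhk using fun i => (hmax i).exists_inverse hS (hh i)
    refine ⟨⟨fun p => ⟨p.1, k p.1 p.2⟩, fun r p =>
      congrArg (Sigma.mk p.1) (map_smul (k p.1) r p.2)⟩, MulActionHom.ext ?_, MulActionHom.ext ?_⟩
    · rintro ⟨i, x⟩
      rw [MulActionHom.comp_apply, hfh]
      exact congrArg (Sigma.mk i) (hkh i x)
    · rintro ⟨i, x⟩
      rw [MulActionHom.comp_apply]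
      exact (hfh i (k i x)).trans (congrArg (Sigma.mk i) (hhk i x))
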